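/- Let $\mathbb F\in\{\mathbb R,\mathbb C\}$, let $\mathcal T=(t_{ijk})\in\mathbb F^{I\times J\times K}$, and let $A=[a_1\,\dots\,a_R]\in\mathbb F^{I\times R}$, $B=[b_1\,\dots\,b_R]\in\mathbb F^{J\times R}$, $C=[c_1\,\dots\,c_R]\in\mathbb F^{K\times R}$ be such that $\mathcal T=[A,B,C]_R$, i.e. $t_{ijk}=\sum_{r=1}^R a_{ir}b_{jr}c_{kr}$ with all terms $a_r\circ b_r\circ c_r$ of rank $1$ (outer products of nonzero vectors). Let $\operatorname{rank} C=K\le R$, $m=R-K+2$, and let $l\ge 0$ be an integer. Let $\mathcal M$ be the set of tuples $r=(r_1,\dots,r_{m+l})$ with $1\le r_1\le\dots\le r_{m+l}\le R$ and at least $m$ distinct entries. Let $\Phi_{m,l}(A,B)$ be the $I^{m+l}J^{m+l}\times|\mathcal M|$ matrix whose entry in the row indexed by $(i_1,\dots,i_{m+l};j_1,\dots,j_{m+l})$ and the column indexed by $r\in\mathcal M$ is $$\frac1{(m!)^2}\sum_{s}\det\big(a_{i_ps_q}\big)_{p,q=1}^m\,\det\big(b_{j_ps_q}\big)_{p,q=1}^m\prod_{p=m+1}^{m+l}a_{i_ps_p}b_{j_ps_p},$$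 where $s=(s_1,\dots,s_{m+l})$ runs over the distinct rearrangements of the tuple $r$ (each counted once). Let $S_{m+l}(C)$ be the $K^{m+l}\times|\mathcal M|$ matrix whose column indexed by $r\in\mathcal M$ is $\frac1{(m+l)!}\sum_{\sigma}c_{r_{\sigma(1)}}\otimes\dots\otimes c_{r_{\sigma(m+l)}}$, the sum being over all permutations $\sigma$ of $\{1,\dots,m+l\}$. Let $U_m$ be a matrix whose columns form a basis of the range of $S_{m+l}(C)^T$. For a matrix $X$, let $k_X$ denote the largest number $k$ such that every $k$ columns of $X$ are linearly independent, and let $A\odot B=[a_1\otimes b_1\ \dots\ a_R\otimes b_R]$. Assume that (i) $k_C\ge1$; (ii) $A\odot B$ has full column rank, i.e. linearly independent columns; (iii) $\min(k_A,k_B)\ge m-1$; (iv) $\Phi_{m,l}(A,B)\,U_m$ has full column rank. Then the rank of $\mathcal T$ (the least number of rank-$1$ tensors that sum to $\mathcal T$) equals $R$, and the third factor matrix of $\mathcal T$ is unique: for any two decompositions $\mathcal T=[\bar A,\bar B,\bar C]_R=[\hat A,\hat B,\hat C]_R$ of $\mathcal T$ into $R=\operatorname{rank}\mathcal T$ rank-$1$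 terms, $\hat C$ and $\bar C$ coincide up to permutation and nonzero scaling of their columns. -/

import Mathlib

open scoped BigOperators

namespace CPD

variable {𝕜 : Type*} [Field 𝕜] {I J K R : ℕ}

/-- A third-order tensor of size `I × J × K`. -/
abbrev Tensor (𝕜 : Type*) (I J K : ℕ) : Type _ := Fin I → Fin J → Fin K → 𝕜

/-- The outer product of three vectors. -/
def outer (a : Fin I → 𝕜) (b : Fin J → 𝕜) (c : Fin K → 𝕜) : Tensor 𝕜 I J K :=
  fun i j k => a i * b j * c k

/-- `T = [A, B, C]_R`: the tensor `T` is the sum of the `R` terms `a_r ∘ b_r ∘ c_r`, each of which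
is a rank-1 tensor, i.e. an outer product of three nonzero vectors. -/
def IsPD (T : Tensor 𝕜 I J K) (A : Matrix (Fin I) (Fin R) 𝕜) (B : Matrix (Fin J) (Fin R) 𝕜)
    (C : Matrix (Fin K) (Fin R) 𝕜) : Prop :=
  (∀ r, A.col r ≠ 0 ∧ B.col r ≠ 0 ∧ C.col r ≠ 0) ∧
    T = ∑ r, outer (A.col r) (B.col r) (C.col r)

/-- The rank of a tensor: the least number of rank-1 tensors that sum to it. -/
noncomputable def tensorRank (T : Tensor 𝕜 I J K) : ℕ :=
  sInf {n : ℕ | ∃ (A : Matrix (Fin I) (Fin n) 𝕜) (B : Matrix (Fin J) (Fin n) 𝕜)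
    (C : Matrix (Fin K) (Fin n) 𝕜), IsPD T A B C}

/-- A canonical polyadic decomposition: a polyadic decomposition with the minimal number of
terms. -/
def IsCPD (T : Tensor 𝕜 I J K) (A : Matrix (Fin I) (Fin R) 𝕜) (B : Matrix (Fin J) (Fin R) 𝕜)
    (C : Matrix (Fin K) (Fin R) 𝕜) : Prop :=
  IsPD T A B C ∧ R = tensorRank T

/-- Two matrices coincide up to permutation and (nonzero) scaling of columns. -/
def ColEquiv (C C' : Matrix (Fin K) (Fin R) 𝕜) : Prop :=
  ∃ (σ : Equiv.Perm (Fin R)) (d : Fin R → 𝕜), (∀ r, d r ≠ 0) ∧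
    ∀ r, C'.col r = d r • C.col (σ r)

/-- The third factor matrix of `T` is unique: the third factor matrices of any two CPDs of `T`
coincide up to column permutation and scaling. -/
def ThirdFactorUnique (T : Tensor 𝕜 I J K) : Prop :=
  ∀ (R : ℕ) (A A' : Matrix (Fin I) (Fin R) 𝕜) (B B' : Matrix (Fin J) (Fin R) 𝕜)
    (C C' : Matrix (Fin K) (Fin R) 𝕜), IsCPD T A B C → IsCPD T A' B' C' → ColEquiv C C'

/-- The columns of the matrix are linearly independent. -/
def FullColumnRank {ι κ : Type*} (M : Matrix ι κ 𝕜) : Prop :=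
  LinearIndependent 𝕜 M.col

/-- The `k`-rank: the largest `k` (at most the number of columns) such that every `k` columns of
the matrix are linearly independent. -/
noncomputable def kRank (M : Matrix (Fin I) (Fin R) 𝕜) : ℕ :=
  sSup {k : ℕ | k ≤ R ∧ ∀ s : Finset (Fin R), s.card = k →
    LinearIndependent 𝕜 (fun r : s => M.col r)}

/-- The Khatri-Rao (columnwise Kronecker) product; the row index `(i, j)` stands for the
position `(i - 1) J + j` (positions starting from 1). -/
def khatriRao (A : Matrix (Fin I) (Fin R) 𝕜) (B : Matrix (Fin J) (Fin R) 𝕜) :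
    Matrix (Fin I × Fin J) (Fin R) 𝕜 :=
  fun ij r => A ij.1 r * B ij.2 r

/-- The index set of the columns of `Φ_{m,l}(A, B)` and `S_{m+l}(C)`: nondecreasing
`(m+l)`-tuples of elements of `{1, …, R}` with at least `m` distinct entries. -/
abbrev Tuples (m l R : ℕ) : Type :=
  {r : Fin (m + l) → Fin R // Monotone r ∧ m ≤ (Finset.univ.image r).card}

/-- The set of the distinct rearrangements of a tuple. -/
def rearrangements {n : ℕ} (r : Fin n → Fin R) : Finset (Fin n → Fin R) :=
  Finset.univ.image fun σ : Equiv.Perm (Fin n) => r ∘ σ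

/-- The matrix `Φ_{m,l}(A, B)`. Its rows are indexed by pairs of tuples
`((i_1, …, i_{m+l}), (j_1, …, j_{m+l}))` and its columns by `Tuples m l R`; the sum runs over the
distinct rearrangements `s` of the column index. -/
noncomputable def Phi (m l : ℕ) (A : Matrix (Fin I) (Fin R) 𝕜) (B : Matrix (Fin J) (Fin R) 𝕜) :
    Matrix ((Fin (m + l) → Fin I) × (Fin (m + l) → Fin J)) (Tuples m l R) 𝕜 :=
  fun ij r => (1 / ((m.factorial : 𝕜) ^ 2)) * ∑ s ∈ rearrangements r.1,
    (Matrix.of fun p q : Fin m => A (ij.1 (Fin.castAdd l p)) (s (Fin.castAdd l q))).det *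
    (Matrix.of fun p q : Fin m => B (ij.2 (Fin.castAdd l p)) (s (Fin.castAdd l q))).det *
    (∏ p : Fin l, A (ij.1 (Fin.natAdd m p)) (s (Fin.natAdd m p))) *
    (∏ p : Fin l, B (ij.2 (Fin.natAdd m p)) (s (Fin.natAdd m p)))

/-- The matrix `S_{m+l}(C)`: the column with index `r` is the average, over all `(m+l)!`
permutations `σ`, of `c_{r_{σ(1)}} ⊗ ⋯ ⊗ c_{r_{σ(m+l)}}`; rows are indexed by tuples
`(k_1, …, k_{m+l})`. -/
noncomputable def S (m l : ℕ) (C : Matrix (Fin K) (Fin R) 𝕜) :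
    Matrix (Fin (m + l) → Fin K) (Tuples m l R) 𝕜 :=
  fun k r => (1 / ((m + l).factorial : 𝕜)) * ∑ σ : Equiv.Perm (Fin (m + l)),
    ∏ p : Fin (m + l), C (k p) (r.1 (σ p))

/-- The columns of `U` form a basis of the range (column space) of `M`. -/
def ColumnsFormBasisOfRange {ι κ ν : Type*} [Fintype κ] (U : Matrix ι ν 𝕜)
    (M : Matrix ι κ 𝕜) : Prop :=
  LinearIndependent 𝕜 U.col ∧ Submodule.span 𝕜 (Set.range U.col) = LinearMap.range M.mulVecLin

end CPD

/-! Contracting the third mode with `f` turns a decomposition into `A D Bᵀ`, where `D` is diagonal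
with entries `d = f ᵥ* C`. A competing decomposition with at most `R` terms gives the same matrix as
`A' D' B'ᵀ`, whose rank is at most the number of nonzero entries of `d' = f ᵥ* C'`. Suppose that
number is at most `R - K + 1 = m - 1`. All `m × m` minors of `A D Bᵀ` then vanish, so by
Cauchy–Binet `Phi` kills the vector of products `∏ d (r p)` (`Phi_mulVec_prod_eq_zero`). That vector
lies in the range of `Sᵀ` (`S_transpose_mulVec_prod`), where `Phi` is injective, so it is zero and
`d` has at most `m - 1` nonzero entries. The k-ranks of `A` and `B` now make the rank of `A D Bᵀ`
exactly the number of nonzero entries of `d`, so `d` has no more of them than `d'`. This is the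
hypothesis of Kruskal's `permutation_lemma`, which matches the columns of `C'` with those of `C` up
to scaling. The matching is a bijection, so no decomposition is shorter. -/

namespace CPD

/-! ### Kruskal's permutation lemma, by counting vectors in subspaces -/

section PermutationLemma

open Module Finset

variable {F E ι κ : Type*} [Field F] [AddCommGroup E] [Module F E]

open Classical in
/-- The number of vectors of the family `c` that lie in the subspace `V`. -/
noncomputable def countIn [Fintype ι] (c : ι → E) (V : Submodule F E) : ℕ :=
  #{i | c i ∈ V}

theorem sup_span_singleton_eq_of_mem {V : Submodule F E} {x y : E} (hx : x ∉ V)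
    (h : x ∈ V ⊔ Submodule.span F {y}) :
    V ⊔ Submodule.span F {x} = V ⊔ Submodule.span F {y} := by
  apply le_antisymm
  · simp [h]
  · obtain ⟨v, hv, w, hw, rfl⟩ := Submodule.mem_sup.1 h
    obtain ⟨t, rfl⟩ := Submodule.mem_span_singleton.1 hw
    have ht : t ≠ 0 := by
      rintro rfl
      simp [hv] at hx
    refine sup_le le_sup_left ?_
    rw [Submodule.span_singleton_le_iff_mem]
    have this' : y = t⁻¹ • (v + t • y) - t⁻¹ • v := by
      rw [smul_add, smul_smul, inv_mul_cancel₀ ht]; simp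
    suffices t⁻¹ • (v + t • y) - t⁻¹ • v ∈ V ⊔ Submodule.span F {v + t • y} by
      rwa [← this'] at this
    refine Submodule.sub_mem _ (Submodule.smul_mem _ _ ?_) (Submodule.smul_mem _ _ ?_)
    · exact Submodule.mem_sup_right (Submodule.mem_span_singleton_self _)
    · exact Submodule.mem_sup_left hv

-- The vectors outside `V` are partitioned by the extension of `V` they generate, and an extension
-- by one dimension gains exactly one class.
open Classical in
theorem countIn_sup_span_singleton [Fintype ι] (c : ι → E) (V : Submodule F E) (y : E) :
    countIn c (V ⊔ Submodule.span F {y}) = countIn c V +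
      #{i | c i ∉ V ∧ V ⊔ Submodule.span F {c i} = V ⊔ Submodule.span F {y}} := by
  unfold countIn
  rw [← card_union_of_disjoint]
  · congr 1
    ext i
    simp only [mem_filter, mem_univ, true_and, mem_union]
    constructor
    · intro h
      by_cases hi : c i ∈ V
      · exact .inl hi
      · exact .inr ⟨hi, sup_span_singleton_eq_of_mem hi h⟩
    · rintro (h | ⟨-, h⟩)
      · exact Submodule.mem_sup_left h
      · rw [← h]
        exact Submodule.mem_sup_right (Submodule.mem_span_singleton_self _)
  · rw [Finset.disjoint_filter]
    intro i _ h1 h2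
    exact h2.1 h1

open Classical in
/-- The inductive step: if the inequality between the counts holds for all one-dimensional
extensions of `V` by vectors of `c'`, it holds for `V`. -/
theorem countIn_le_of_extensions [Fintype ι] [Fintype κ] [FiniteDimensional F E]
    (c : ι → E) (c' : κ → E)
    (hspan : Submodule.span F (Set.range c') = ⊤) (V : Submodule F E)
    (hV : finrank F V + 2 ≤ finrank F E)
    (h : ∀ j, c' j ∉ V → countIn c' (V ⊔ Submodule.span F {c' j}) + Fintype.card ι ≤
      countIn c (V ⊔ Submodule.span F {c' j}) + Fintype.card κ) :
    countIn c' V + Fintype.card ι ≤ countIn c V + Fintype.card κ := by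
  set N : Finset κ := {j | c' j ∉ V} with hN
  set W : Finset (Submodule F E) := N.image fun j => V ⊔ Submodule.span F {c' j} with hW
  -- `V` has codimension at least 2 and `c'` spans, so a single one-dimensional extension cannot
  -- absorb all of `c'`.
  have two_le : 2 ≤ #W := by
    by_contra! hlt
    have hle : #W ≤ 1 := by omega
    have key : ∃ y : E, ∀ j, c' j ∈ V ⊔ Submodule.span F {y} := by
      by_cases hne : N.Nonempty
      · obtain ⟨j₀, hj₀⟩ := hne
        refine ⟨c' j₀, fun j => ?_⟩
        by_cases hj : c' j ∈ V
        · exact Submodule.mem_sup_left hj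
        · have := card_le_one.1 hle _ (mem_image_of_mem _ (show j ∈ N by simp [hN, hj])) _
            (mem_image_of_mem _ hj₀)
          refine this ▸ ?_
          exact Submodule.mem_sup_right (Submodule.mem_span_singleton_self _)
      · refine ⟨0, fun j => ?_⟩
        by_contra hj
        refine hne ⟨j, ?_⟩
        simp only [hN, mem_filter, mem_univ, true_and]
        exact fun h => hj (Submodule.mem_sup_left h)
    obtain ⟨y, hy⟩ := key
    have htop : V ⊔ Submodule.span F {y} = ⊤ := by
      rw [eq_top_iff, ← hspan, Submodule.span_le]
      rintro _ ⟨j, rfl⟩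
      exact hy j
    have h1 := Submodule.finrank_add_le_finrank_add_finrank V (Submodule.span F {y})
    rw [htop, finrank_top] at h1
    have h2 := finrank_span_le_card (R := F) ({y} : Set E)
    simp at h2
    omega
  have hκ : Fintype.card κ = countIn c' V +
      ∑ L ∈ W, #{j | c' j ∉ V ∧ V ⊔ Submodule.span F {c' j} = L} := by
    have h1 := card_eq_sum_card_fiberwise (f := fun j => V ⊔ Submodule.span F {c' j})
      (s := N) (t := W) (fun j hj => mem_image_of_mem _ hj)
    have h2 := card_filter_add_card_filter_not (s := (univ : Finset κ)) (fun j => c' j ∈ V)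
    rw [card_univ] at h2
    simp only [hN, filter_filter] at h1
    rw [← h2, h1]
    rfl
  -- Only an inequality: some `c i` may generate extensions outside `W`.
  have hι : countIn c V + ∑ L ∈ W, #{i | c i ∉ V ∧ V ⊔ Submodule.span F {c i} = L} ≤
      Fintype.card ι := by
    have h2 := card_filter_add_card_filter_not (s := (univ : Finset ι)) (fun j => c j ∈ V)
    rw [card_univ] at h2
    rw [← h2]
    refine Nat.add_le_add_left ?_ _
    have h1 := sum_card_fiberwise_eq_card_filter ({i | c i ∉ V} : Finset ι) W
      (fun i => V ⊔ Submodule.span F {c i})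
    simp only [filter_filter] at h1
    rw [h1]
    exact card_le_card fun i hi => by simpa using (mem_filter.1 hi).2.1
  have hsum : ∑ L ∈ W, (countIn c' V + #{j | c' j ∉ V ∧ V ⊔ Submodule.span F {c' j} = L} +
      Fintype.card ι) ≤
      ∑ L ∈ W, (countIn c V + #{i | c i ∉ V ∧ V ⊔ Submodule.span F {c i} = L} +
      Fintype.card κ) := by
    refine sum_le_sum fun L hL => ?_
    obtain ⟨j, hj, rfl⟩ := mem_image.1 hL
    have := h j (by simpa [hN] using hj)
    rwa [countIn_sup_span_singleton, countIn_sup_span_singleton] at this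
  simp only [sum_add_distrib, sum_const, smul_eq_mul] at hsum
  -- With `hκ` and `hι`, the summed inequality becomes the goal multiplied by `#W - 1`, which is
  -- positive.
  by_contra! hlt
  nlinarith

/-- Induction on the codimension carries the inequality from hyperplanes down to every span of
vectors of `c'`. Equivalently, `c` has no more vectors outside such a span than `c'`. -/
theorem countIn_le_of_mem_spans [Fintype ι] [Fintype κ] [FiniteDimensional F E]
    (c : ι → E) (c' : κ → E)
    (hspan : Submodule.span F (Set.range c') = ⊤)
    (h : ∀ V : Submodule F E, finrank F V + 1 = finrank F E → finrank F E ≤ countIn c' V + 1 →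
      countIn c' V + Fintype.card ι ≤ countIn c V + Fintype.card κ)
    (s : Set κ) :
    countIn c' (Submodule.span F (c' '' s)) + Fintype.card ι ≤
      countIn c (Submodule.span F (c' '' s)) + Fintype.card κ := by
  classical
  obtain ⟨n, hn⟩ : ∃ n, finrank F (Submodule.span F (c' '' s)) + n = finrank F E :=
    ⟨_, Nat.add_sub_of_le (Submodule.finrank_le _)⟩
  induction n generalizing s with
  | zero =>
    rw [Submodule.eq_top_of_finrank_eq (S := Submodule.span F (c' '' s)) (by omega)]
    simp [countIn, add_comm]
  | succ n ih =>
    by_cases hn0 : n = 0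
    · subst hn0
      refine h _ hn ?_
      -- A hyperplane spanned by members of `c'` contains at least as many of them as its dimension,
      -- which is the side condition of `h`.
      have h1 : Submodule.span F (c' '' s) ≤ Submodule.span F
          (((({j | c' j ∈ Submodule.span F (c' '' s)} : Finset κ)).image c' : Finset E) : Set E) := by
        refine Submodule.span_mono ?_
        rintro _ ⟨j, hj, rfl⟩
        simp only [coe_image, coe_filter, mem_univ, true_and]
        exact ⟨j, Submodule.subset_span ⟨j, hj, rfl⟩, rfl⟩
      have h2 := Submodule.finrank_mono h1
      have h3 := finrank_span_finset_le_card (R := F)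
        ((({j | c' j ∈ Submodule.span F (c' '' s)} : Finset κ)).image c')
      have h4 := card_image_le (s := ({j | c' j ∈ Submodule.span F (c' '' s)} : Finset κ))
        (f := c')
      unfold countIn
      rw [Set.finrank] at h3
      have h5 : #({j | c' j ∈ Submodule.span F (c' '' s)} : Finset κ) =
        @Finset.card κ (@Finset.filter κ (fun j => c' j ∈ Submodule.span F (c' '' s))
          (fun a => Classical.propDecidable _) univ) := by congr!
      omega
    · refine countIn_le_of_extensions c c' hspan _ (by omega) fun j hj => ?_
      have hins : Submodule.span F (c' '' s) ⊔ Submodule.span F {c' j} =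
          Submodule.span F (c' '' insert j s) := by
        rw [Set.image_insert_eq, Submodule.span_insert, sup_comm]
      have hd := Submodule.finrank_sup_span_singleton hj
      rw [hins] at hd ⊢
      exact ih _ (by omega)

theorem span_range_eq_top_of_forall_dual {c : ι → E}
    (h : ∀ φ : Dual F E, (∀ i, φ (c i) = 0) → φ = 0) :
    Submodule.span F (Set.range c) = ⊤ := by
  by_contra hne
  obtain ⟨φ, hφ, hle⟩ := Submodule.exists_le_ker_of_lt_top _ (lt_top_iff_ne_top.2 hne)
  exact hφ (h φ fun i => hle (Submodule.subset_span ⟨i, rfl⟩))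

/-- A combinatorial matching: if the fibres of `g'` are no larger than those of `g`, and `ι` is
no larger than `κ`, then `g'` is a relabelling of `g`. -/
theorem exists_equiv_of_card_fibers_le {α : Type*} [DecidableEq α] [Fintype ι] [Fintype κ]
    (g : ι → α) (g' : κ → α)
    (hcard : Fintype.card ι ≤ Fintype.card κ)
    (h : ∀ j, #{k | g' k = g' j} ≤ #{i | g i = g' j}) :
    ∃ e : κ ≃ ι, ∀ j, g (e j) = g' j := by
  have hemb : ∀ a, Nonempty ({j // g' j = a} ↪ {i // g i = a}) := by
    intro a
    by_cases ha : ∃ j, g' j = a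
    · obtain ⟨j, rfl⟩ := ha
      apply Function.Embedding.nonempty_of_card_le
      rw [Fintype.card_subtype, Fintype.card_subtype]
      exact h j
    · have : IsEmpty {j // g' j = a} := ⟨fun j => ha ⟨j.1, j.2⟩⟩
      exact ⟨Function.Embedding.ofIsEmpty⟩
  let f := fun a => (hemb a).some
  let e : κ → ι := fun j => (f (g' j) ⟨j, rfl⟩).1
  have he : ∀ j, g (e j) = g' j := fun j => (f (g' j) ⟨j, rfl⟩).2
  have aux : ∀ j a (h : g' j = a), e j = (f a ⟨j, h⟩).1 := by
    rintro j _ rfl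
    rfl
  have hinj : Function.Injective e := by
    intro j k hjk
    have hg : g' j = g' k := by rw [← he j, ← he k, hjk]
    rw [aux j _ hg, aux k _ rfl] at hjk
    exact congrArg Subtype.val ((f (g' k)).injective (Subtype.ext hjk))
  have hc : Fintype.card κ = Fintype.card ι :=
    le_antisymm (Fintype.card_le_of_injective e hinj) hcard
  exact ⟨Equiv.ofBijective e ((Fintype.bijective_iff_injective_and_card e).2 ⟨hinj, hc⟩), he⟩

theorem span_singleton_eq_iff_mem {x y : E} (hy : y ≠ 0) :
    y ∈ Submodule.span F {x} ↔ Submodule.span F {y} = Submodule.span F {x} := by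
  constructor
  · intro h
    have := sup_span_singleton_eq_of_mem (F := F) (V := ⊥) (x := y) (y := x) (by simpa using hy)
      (by simpa using h)
    simpa using this
  · intro h
    rw [← h]
    exact Submodule.mem_span_singleton_self y

open Classical in
/-- Kruskal's permutation lemma for a spanning family `c` of nonzero vectors. -/
theorem permutation_lemma [Fintype ι] [Fintype κ] [FiniteDimensional F E]
    (c : ι → E) (c' : κ → E) (hc : ∀ i, c i ≠ 0) (hc' : ∀ j, c' j ≠ 0)
    (hspan : Submodule.span F (Set.range c) = ⊤)
    (hcard : Fintype.card κ ≤ Fintype.card ι)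
    (h : ∀ φ : Dual F E, #{j | φ (c' j) ≠ 0} + finrank F E ≤ Fintype.card ι + 1 →
      #{i | φ (c i) ≠ 0} ≤ #{j | φ (c' j) ≠ 0}) :
    ∃ e : κ ≃ ι, ∀ j, Submodule.span F {c (e j)} = Submodule.span F {c' j} := by
  have hfin : finrank F E ≤ Fintype.card ι := by
    have := finrank_range_le_card (R := F) c
    rwa [Set.finrank, hspan, finrank_top] at this
  have hspan' : Submodule.span F (Set.range c') = ⊤ := by
    refine span_range_eq_top_of_forall_dual fun φ hφ => ?_
    have h0 := h φ (by simp [hφ]; omega)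
    simp only [hφ, ne_eq, not_true_eq_false, filter_false, card_empty, nonpos_iff_eq_zero,
      card_eq_zero, filter_eq_empty_iff, mem_univ, not_not, forall_const] at h0
    rw [← LinearMap.ker_eq_top, eq_top_iff, ← hspan, Submodule.span_le]
    rintro _ ⟨i, rfl⟩
    exact @h0 i
  -- A hyperplane is the kernel of a functional, so `h` compares the numbers of vectors outside it.
  have main := countIn_le_of_mem_spans c c' hspan' (by
    intro V hV hVc
    have hlt : V < ⊤ := by
      rw [lt_top_iff_ne_top]
      rintro rfl
      rw [finrank_top] at hV
      omega
    obtain ⟨φ, hφ, hle⟩ := Submodule.exists_le_ker_of_lt_top _ hlt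
    have hker : V = LinearMap.ker φ := by
      refine Submodule.eq_of_le_of_finrank_le hle ?_
      have : finrank F (LinearMap.ker φ) < finrank F E := by
        apply Submodule.finrank_lt
        rwa [Ne, LinearMap.ker_eq_top]
      omega
    have e1 := card_filter_add_card_filter_not (s := (univ : Finset κ)) (fun j => c' j ∈ V)
    have e2 := card_filter_add_card_filter_not (s := (univ : Finset ι)) (fun j => c j ∈ V)
    rw [card_univ] at e1 e2
    have hφV : ∀ x, φ x ≠ 0 ↔ x ∉ V := by
      intro x
      rw [hker, LinearMap.mem_ker]
    have := h φ
    simp only [hφV] at this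
    unfold countIn at *
    omega)
  have hle : Fintype.card ι ≤ Fintype.card κ := by
    -- The empty set spans `⊥`, which contains no vector of either family.
    have := main ∅
    simpa [countIn, hc, hc'] using this
  refine exists_equiv_of_card_fibers_le (fun i => Submodule.span F {c i})
    (fun j => Submodule.span F {c' j}) hle fun j => ?_
  have := main {j}
  simp only [Set.image_singleton, countIn, span_singleton_eq_iff_mem (hc _),
    span_singleton_eq_iff_mem (hc' _)] at this
  omega

end PermutationLemma

variable {𝕜 : Type*} [Field 𝕜] {I J K R : ℕ}

/-! ### Ranks and minors of `A D Bᵀ` -/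

section RankLemmas

open Matrix Finset

theorem linearIndependent_of_card_le_kRank (M : Matrix (Fin I) (Fin R) 𝕜) (s : Finset (Fin R))
    (hs : #s ≤ kRank M) : LinearIndependent 𝕜 (fun r : s => M.col r) := by
  have hmem : kRank M ∈ {k : ℕ | k ≤ R ∧ ∀ s : Finset (Fin R), s.card = k →
      LinearIndependent 𝕜 (fun r : s => M.col r)} := by
    refine Nat.sSup_mem ⟨0, by simp, fun s hs => ?_⟩ ⟨R, fun k hk => hk.1⟩
    have : IsEmpty s := by
      rw [card_eq_zero] at hs
      subst hs
      infer_instance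
    exact linearIndependent_empty_type
  obtain ⟨t, hst, ht⟩ := exists_superset_card_eq hs (by simpa using hmem.1)
  exact (hmem.2 t ht).comp (Set.inclusion hst) (Set.inclusion_injective hst)

theorem rank_mul_eq_right_of_linearIndependent_col {α β γ : Type*} [Fintype β] [Fintype γ]
    (P : Matrix α β 𝕜) (Q : Matrix β γ 𝕜) (hP : LinearIndependent 𝕜 P.col) :
    (P * Q).rank = Q.rank := by
  have hinj : Function.Injective P.mulVecLin := Matrix.mulVec_injective_iff.2 hP
  rw [rank, rank, mulVecLin_mul, LinearMap.range_comp]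
  exact (Submodule.equivMapOfInjective P.mulVecLin hinj _).finrank_eq.symm

open Classical in
theorem rank_mul_diagonal_mul_transpose_le (A : Matrix (Fin I) (Fin R) 𝕜)
    (B : Matrix (Fin J) (Fin R) 𝕜) (d : Fin R → 𝕜) :
    (A * diagonal d * Bᵀ).rank ≤ #{r | d r ≠ 0} := by
  refine (rank_mul_le_left _ _).trans ((rank_mul_le_right _ _).trans ?_)
  rw [rank_diagonal, Fintype.card_subtype]

open Classical in
theorem rank_mul_diagonal_mul_transpose (A : Matrix (Fin I) (Fin R) 𝕜)
    (B : Matrix (Fin J) (Fin R) 𝕜) (d : Fin R → 𝕜)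
    (hA : #{r | d r ≠ 0} ≤ kRank A) (hB : #{r | d r ≠ 0} ≤ kRank B) :
    (A * diagonal d * Bᵀ).rank = #{r | d r ≠ 0} := by
  set s : Finset (Fin R) := {r | d r ≠ 0} with hs
  let A' : Matrix (Fin I) s 𝕜 := A.submatrix id Subtype.val
  let B' : Matrix (Fin J) s 𝕜 := B.submatrix id Subtype.val
  let D : Matrix s s 𝕜 := diagonal fun r => d r
  have hA' : LinearIndependent 𝕜 A'.col := linearIndependent_of_card_le_kRank A s hA
  have hB' : LinearIndependent 𝕜 B'.col := linearIndependent_of_card_le_kRank B s hB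
  -- Restricted to the support of `d`, both factors have independent columns and `D` is invertible.
  have hprod : A * diagonal d * Bᵀ = A' * (B' * D)ᵀ := by
    ext i j
    rw [mul_apply, mul_apply]
    simp only [D, transpose_apply, mul_diagonal, A', B', submatrix_apply, id]
    rw [sum_coe_sort s (fun r => A i r * (B j r * d r))]
    rw [← sum_subset (subset_univ s)]
    · exact sum_congr rfl fun r _ => by ring
    · intro r _ hr
      have : d r = 0 := by simpa [hs] using hr
      simp [this]
  rw [hprod, rank_mul_eq_right_of_linearIndependent_col _ _ hA', rank_transpose,
    rank_mul_eq_right_of_linearIndependent_col _ _ hB', rank_diagonal]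
  have : ∀ r : s, d r ≠ 0 := fun r => (mem_filter.1 r.2).2
  simp [this]

theorem det_submatrix_eq_zero_of_rank_lt {α β : Type*} [Fintype β] (M : Matrix α β 𝕜) {m : ℕ}
    (hM : M.rank < m) (i : Fin m → α) (j : Fin m → β) : (M.submatrix i j).det = 0 := by
  by_contra h
  have h1 := rank_of_isUnit (M.submatrix i j) ((isUnit_iff_isUnit_det _).2 (isUnit_iff_ne_zero.2 h))
  have h2 := rank_submatrix_le M i j
  rw [h1, Fintype.card_fin] at h2
  omega

/-- Multilinear expansion of a determinant whose columns are linear combinations. -/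
theorem det_sum_columns {m : ℕ} {ρ : Type*} [Fintype ρ] [DecidableEq ρ] (P : Fin m → ρ → 𝕜)
    (Q : ρ → Fin m → 𝕜) :
    (Matrix.of fun p q : Fin m => ∑ r, P p r * Q r q).det =
      ∑ s : Fin m → ρ, (Matrix.of fun p q : Fin m => P p (s q)).det * ∏ q, Q (s q) q := by
  simp only [det_apply', of_apply, prod_univ_sum, Fintype.piFinset_univ, mul_sum, sum_mul]
  rw [sum_comm]
  refine sum_congr rfl fun s _ => sum_congr rfl fun σ _ => ?_
  rw [prod_mul_distrib]
  ring

/-- A form of the Cauchy–Binet argument: the sum vanishes if the rank of `A D Bᵀ` is less than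
the size of the minors. -/
theorem sum_det_mul_det_eq_zero {m : ℕ} (A : Matrix (Fin I) (Fin R) 𝕜)
    (B : Matrix (Fin J) (Fin R) 𝕜) (d : Fin R → 𝕜) (h : (A * diagonal d * Bᵀ).rank < m)
    (i : Fin m → Fin I) (j : Fin m → Fin J) :
    ∑ s : Fin m → Fin R, (Matrix.of fun p q : Fin m => A (i p) (s q)).det *
      (Matrix.of fun p q : Fin m => B (j p) (s q)).det * ∏ q, d (s q) = 0 := by
  -- Expanding the second determinant over `τ` leaves, for each `τ`, a minor of `A D Bᵀ` with
  -- permuted columns.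
  have key : ∀ τ : Equiv.Perm (Fin m),
      ∑ s : Fin m → Fin R, (Matrix.of fun p q : Fin m => A (i p) (s q)).det *
        ∏ q, (d (s q) * B (j (τ q)) (s q)) = 0 := by
    intro τ
    rw [← det_sum_columns (fun p r => A (i p) r) (fun r q => d r * B (j (τ q)) r),
      ← det_submatrix_eq_zero_of_rank_lt _ h i (j ∘ τ)]
    congr 1
    ext p q
    rw [of_apply, submatrix_apply, mul_apply]
    simp only [mul_diagonal, transpose_apply, Function.comp_apply]
    exact sum_congr rfl fun r _ => by ring
  calc _ = ∑ τ : Equiv.Perm (Fin m), ((Equiv.Perm.sign τ : ℤ) : 𝕜) *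
        ∑ s : Fin m → Fin R, (Matrix.of fun p q : Fin m => A (i p) (s q)).det *
        ∏ q, (d (s q) * B (j (τ q)) (s q)) := by
        simp only [mul_sum]
        rw [sum_comm]
        refine sum_congr rfl fun s _ => ?_
        rw [det_apply' (Matrix.of fun p q : Fin m => B (j p) (s q)), mul_sum, sum_mul]
        refine sum_congr rfl fun τ _ => ?_
        simp only [of_apply, prod_mul_distrib]
        ring
    _ = 0 := by simp [key]

end RankLemmas

/-! ### Sorted tuples and their rearrangements -/

section Tuples

open Finset

theorem mem_rearrangements {n : ℕ} {r s : Fin n → Fin R} :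
    s ∈ rearrangements r ↔ ∃ σ : Equiv.Perm (Fin n), r ∘ σ = s := by
  simp [rearrangements]

theorem eq_of_monotone_of_comp_perm {n : ℕ} {r r' : Fin n → Fin R} (hr : Monotone r)
    (hr' : Monotone r') (σ : Equiv.Perm (Fin n)) (h : r ∘ σ = r') : r = r' := by
  subst h
  have := Tuple.unique_monotone (f := r) (σ := 1) (τ := σ) (by simpa using hr) hr'
  simpa using this

theorem image_univ_comp_perm {n : ℕ} (r : Fin n → Fin R) (σ : Equiv.Perm (Fin n)) :
    univ.image (r ∘ σ) = univ.image r := by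
  rw [← image_image]
  congr 1
  exact image_univ_of_surjective σ.surjective

/-- Summing over all rearrangements of all admissible tuples amounts to summing over all tuples
with at least `m` distinct entries. -/
theorem sum_tuples_rearrangements {m l : ℕ} (f : (Fin (m + l) → Fin R) → 𝕜)
    (hf : ∀ s, #(univ.image s) < m → f s = 0) :
    ∑ r : Tuples m l R, ∑ s ∈ rearrangements r.1, f s = ∑ s, f s := by
  classical
  rw [← sum_biUnion]
  · refine sum_subset (subset_univ _) fun s _ hs => hf s ?_
    by_contra! hle
    refine hs (mem_biUnion.2 ⟨⟨s ∘ Tuple.sort s, Tuple.monotone_sort s, ?_⟩, mem_univ _, ?_⟩)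
    · rwa [image_univ_comp_perm]
    · refine mem_rearrangements.2 ⟨(Tuple.sort s)⁻¹, ?_⟩
      ext p
      simp
  · intro r _ r' _ hne
    rw [Function.onFun, disjoint_left]
    intro s hs hs'
    obtain ⟨σ, rfl⟩ := mem_rearrangements.1 hs
    obtain ⟨τ, hτ⟩ := mem_rearrangements.1 hs'
    refine hne (Subtype.ext (eq_of_monotone_of_comp_perm r.2.1 r'.2.1 (σ * τ⁻¹) ?_))
    rw [Equiv.Perm.coe_mul, ← Function.comp_assoc, ← hτ, Function.comp_assoc,
      ← Equiv.Perm.coe_mul, mul_inv_cancel, Equiv.Perm.coe_one, Function.comp_id]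

end Tuples

/-! ### Product vectors in the kernel of `Phi` and the range of `Sᵀ` -/

section Injectivity

open Matrix Finset

theorem Phi_mulVec_prod_eq_zero {m l : ℕ} (A : Matrix (Fin I) (Fin R) 𝕜)
    (B : Matrix (Fin J) (Fin R) 𝕜) (d : Fin R → 𝕜) (h : (A * diagonal d * Bᵀ).rank < m) :
    Phi m l A B *ᵥ (fun r => ∏ p, d (r.1 p)) = 0 := by
  ext ⟨i, j⟩
  let g : (Fin (m + l) → Fin R) → 𝕜 := fun s =>
    (Matrix.of fun p q : Fin m => A (i (Fin.castAdd l p)) (s (Fin.castAdd l q))).det *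
    (Matrix.of fun p q : Fin m => B (j (Fin.castAdd l p)) (s (Fin.castAdd l q))).det *
    (∏ p : Fin l, A (i (Fin.natAdd m p)) (s (Fin.natAdd m p))) *
    (∏ p : Fin l, B (j (Fin.natAdd m p)) (s (Fin.natAdd m p))) * ∏ p, d (s p)
  -- With fewer than `m` distinct values, two of the first `m` entries agree and the determinant has
  -- equal columns.
  have hg : ∀ s, #(univ.image s) < m → g s = 0 := by
    intro s hs
    have hninj : ¬ Function.Injective fun q : Fin m => s (Fin.castAdd l q) := by
      intro hinj
      have h1 := card_image_of_injective univ hinj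
      rw [card_univ, Fintype.card_fin] at h1
      have h2 : (univ.image fun q : Fin m => s (Fin.castAdd l q)) ⊆ univ.image s := by
        intro x hx
        obtain ⟨q, -, rfl⟩ := mem_image.1 hx
        exact mem_image_of_mem _ (mem_univ _)
      have := card_le_card h2
      omega
    obtain ⟨q, q', hqq, hne⟩ : ∃ q q' : Fin m,
        s (Fin.castAdd l q) = s (Fin.castAdd l q') ∧ q ≠ q' := by
      simpa [Function.Injective] using hninj
    have : (Matrix.of fun p q : Fin m => A (i (Fin.castAdd l p)) (s (Fin.castAdd l q))).det = 0 :=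
      det_zero_of_column_eq hne fun p => by simp [hqq]
    simp [g, this]
  have h1 : (Phi m l A B *ᵥ fun r => ∏ p, d (r.1 p)) (i, j) =
      (1 / ((m.factorial : 𝕜) ^ 2)) * ∑ r : Tuples m l R, ∑ s ∈ rearrangements r.1, g s := by
    simp only [mulVec, dotProduct, Phi, mul_sum, sum_mul]
    refine sum_congr rfl fun r _ => sum_congr rfl fun s hs => ?_
    obtain ⟨σ, rfl⟩ := mem_rearrangements.1 hs
    have : ∏ p, d ((r.1 ∘ σ) p) = ∏ p, d (r.1 p) := Equiv.prod_comp σ fun p => d (r.1 p)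
    simp only [g, this]
    ring
  rw [h1, sum_tuples_rearrangements g hg]
  -- For a fixed tail of length `l`, the sum over the first `m` entries is the Cauchy–Binet sum.
  have h2 : ∑ s, g s = ∑ x : (Fin m → Fin R) × (Fin l → Fin R), g (Fin.append x.1 x.2) :=
    (Equiv.sum_comp (Fin.appendEquiv m l) g).symm
  rw [h2, Fintype.sum_prod_type, sum_comm]
  simp only [Pi.zero_apply]
  rw [sum_eq_zero, mul_zero]
  intro y _
  have h3 := sum_det_mul_det_eq_zero A B d h (fun p => i (Fin.castAdd l p))
    (fun p => j (Fin.castAdd l p))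
  calc _ = (∑ s : Fin m → Fin R,
      (Matrix.of fun p q : Fin m => A (i (Fin.castAdd l p)) (s q)).det *
      (Matrix.of fun p q : Fin m => B (j (Fin.castAdd l p)) (s q)).det * ∏ q, d (s q)) *
      ((∏ p : Fin l, A (i (Fin.natAdd m p)) (y p)) * (∏ p : Fin l, B (j (Fin.natAdd m p)) (y p)) *
        ∏ p, d (y p)) := by
        rw [sum_mul]
        refine sum_congr rfl fun x _ => ?_
        simp only [g, Fin.append_left, Fin.append_right, Fin.prod_univ_add]
        ring
    _ = 0 := by rw [h3, zero_mul]

/-- Pairing `f ⊗ ⋯ ⊗ f` with a product of columns is insensitive to their order, so the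
symmetrization averages equal terms. -/
theorem S_transpose_mulVec_prod [CharZero 𝕜] (m l : ℕ) (C : Matrix (Fin K) (Fin R) 𝕜)
    (f : Fin K → 𝕜) :
    (S m l C)ᵀ *ᵥ (fun k => ∏ p, f (k p)) = fun r => ∏ p, (f ᵥ* C) (r.1 p) := by
  ext r
  simp only [mulVec, dotProduct, transpose_apply, S, vecMul]
  calc _ = (1 / ((m + l).factorial : 𝕜)) * ∑ σ : Equiv.Perm (Fin (m + l)),
        ∑ k : Fin (m + l) → Fin K, ∏ p, (f (k p) * C (k p) (r.1 (σ p))) := by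
        rw [sum_comm, mul_sum]
        refine sum_congr rfl fun k _ => ?_
        simp only [prod_mul_distrib, ← mul_sum]
        ring
    _ = (1 / ((m + l).factorial : 𝕜)) * ∑ σ : Equiv.Perm (Fin (m + l)),
        ∏ p, ∑ k, f k * C k (r.1 p) := by
        congr 1
        refine sum_congr rfl fun σ _ => ?_
        rw [← Equiv.prod_comp σ, prod_univ_sum, Fintype.piFinset_univ]
    _ = _ := by
        have : ((m + l).factorial : 𝕜) ≠ 0 := Nat.cast_ne_zero.2 (Nat.factorial_ne_zero _)
        rw [sum_const, card_univ, Fintype.card_perm, Fintype.card_fin, nsmul_eq_mul]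
        field_simp

open Classical in
/-- If all the products of entries of `d` over admissible tuples vanish, then `d` has fewer than
`m` nonzero entries. -/
theorem card_support_lt_of_prod_eq_zero {m l : ℕ} (hm : 0 < m) (d : Fin R → 𝕜)
    (h : ∀ r : Tuples m l R, ∏ p, d (r.1 p) = 0) : #{r | d r ≠ 0} < m := by
  by_contra! hle
  obtain ⟨t, ht, htc⟩ := exists_subset_card_eq hle
  let x : Fin m → Fin R := fun p => t.orderEmbOfFin htc p
  have hx : ∀ p, d (x p) ≠ 0 := fun p => by
    simpa using ht (t.orderEmbOfFin_mem htc p)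
  -- Padding by a repeated support index keeps the `m` distinct entries and every factor nonzero.
  let s : Fin (m + l) → Fin R := Fin.append x fun _ => x ⟨0, hm⟩
  have hs : ∀ p, d (s p) ≠ 0 := by
    intro p
    refine Fin.addCases (fun q => ?_) (fun q => ?_) p
    · simpa [s] using hx q
    · simpa [s] using hx _
  have hcard : m ≤ #(univ.image s) := by
    have h1 := card_image_of_injective univ (t.orderEmbOfFin htc).injective
    rw [card_univ, Fintype.card_fin] at h1
    refine h1.ge.trans (card_le_card fun y hy => ?_)
    obtain ⟨q, -, rfl⟩ := mem_image.1 hy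
    exact mem_image.2 ⟨Fin.castAdd l q, mem_univ _, by simp [s, x]⟩
  have := h ⟨s ∘ Tuple.sort s, Tuple.monotone_sort s, by rwa [image_univ_comp_perm]⟩
  obtain ⟨p, -, hp⟩ := prod_eq_zero_iff.1 this
  exact hs _ hp

open Classical in
/-- If `Φ` is injective on the range of `Sᵀ`, then every `d` in the row space of `C` such that
`A D Bᵀ` has rank less than `m` has fewer than `m` nonzero entries. -/
theorem card_support_lt_of_rank_lt [CharZero 𝕜] {m l u : ℕ} (hm : 0 < m)
    (A : Matrix (Fin I) (Fin R) 𝕜) (B : Matrix (Fin J) (Fin R) 𝕜) (C : Matrix (Fin K) (Fin R) 𝕜)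
    (U : Matrix (Tuples m l R) (Fin u) 𝕜) (hU : ColumnsFormBasisOfRange U (S m l C)ᵀ)
    (hPhi : FullColumnRank (Phi m l A B * U)) (f : Fin K → 𝕜)
    (h : (A * diagonal (f ᵥ* C) * Bᵀ).rank < m) : #{r | (f ᵥ* C) r ≠ 0} < m := by
  refine card_support_lt_of_prod_eq_zero (l := l) hm _ fun r => ?_
  have hmem : (fun r : Tuples m l R => ∏ p, (f ᵥ* C) (r.1 p)) ∈
      Submodule.span 𝕜 (Set.range U.col) := by
    rw [hU.2]
    exact ⟨fun k => ∏ p, f (k p), S_transpose_mulVec_prod m l C f⟩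
  rw [← Matrix.range_mulVecLin] at hmem
  obtain ⟨w, hw⟩ := hmem
  rw [mulVecLin_apply] at hw
  have hinj : Function.Injective (Phi m l A B * U).mulVec := Matrix.mulVec_injective_iff.2 hPhi
  have hw0 : w = 0 := by
    apply hinj
    simp only [mulVec_zero]
    rw [← mulVec_mulVec, hw]
    exact Phi_mulVec_prod_eq_zero A B _ h
  rw [hw0, mulVec_zero] at hw
  exact (congrFun hw r).symm

end Injectivity

/-! ### Comparing two decompositions -/

section Main

open Matrix Finset

/-- Contracting the third mode of `[A, B, C]_R` with `f` gives `A D Bᵀ` with `D` the diagonal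
matrix of `Cᵀ f`. -/
theorem IsPD.contract_eq {T : Tensor 𝕜 I J K} {A : Matrix (Fin I) (Fin R) 𝕜}
    {B : Matrix (Fin J) (Fin R) 𝕜} {C : Matrix (Fin K) (Fin R) 𝕜} (h : IsPD T A B C)
    (f : Fin K → 𝕜) :
    A * diagonal (f ᵥ* C) * Bᵀ = Matrix.of fun i j => ∑ k, T i j k * f k := by
  ext i j
  rw [mul_apply, of_apply, h.2]
  simp only [mul_diagonal, transpose_apply, vecMul, dotProduct, Finset.sum_apply, outer, col_apply,
    mul_sum, sum_mul]
  rw [sum_comm]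
  exact sum_congr rfl fun k _ => sum_congr rfl fun r _ => by ring

theorem dual_apply_col (φ : Module.Dual 𝕜 (Fin K → 𝕜)) (C : Matrix (Fin K) (Fin R) 𝕜) (r : Fin R) :
    φ (C.col r) = ((fun k => φ (Pi.single k 1)) ᵥ* C) r := by
  rw [LinearMap.pi_apply_eq_sum_univ φ]
  simp only [vecMul, dotProduct, col_apply, smul_eq_mul]
  refine sum_congr rfl fun k _ => ?_
  rw [mul_comm]
  congr 2
  ext i
  simp [Pi.single_apply, eq_comm]

theorem exists_smul_of_span_singleton_eq {E : Type*} [AddCommGroup E] [Module 𝕜 E] {x y : E}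
    (hy : y ≠ 0) (h : Submodule.span 𝕜 {x} = Submodule.span 𝕜 {y}) : ∃ t : 𝕜, t ≠ 0 ∧ y = t • x := by
  have : y ∈ Submodule.span 𝕜 {x} := by
    rw [h]
    exact Submodule.mem_span_singleton_self y
  obtain ⟨t, rfl⟩ := Submodule.mem_span_singleton.1 this
  refine ⟨t, ?_, rfl⟩
  rintro rfl
  simp at hy

/-- Allowing `R' ≤ R` lets one statement serve both the rank and the uniqueness claim. -/
theorem exists_equiv_of_isPD [CharZero 𝕜] {T : Tensor 𝕜 I J K}
    {A : Matrix (Fin I) (Fin R) 𝕜} {B : Matrix (Fin J) (Fin R) 𝕜} {C : Matrix (Fin K) (Fin R) 𝕜}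
    (hT : IsPD T A B C) (hCK : C.rank = K) (hKR : K ≤ R) {m l : ℕ} (hm : m = R - K + 2)
    {u : ℕ} (U : Matrix (Tuples m l R) (Fin u) 𝕜) (hU : ColumnsFormBasisOfRange U (S m l C)ᵀ)
    (hkAB : m - 1 ≤ min (kRank A) (kRank B)) (hPhi : FullColumnRank (Phi m l A B * U))
    {R' : ℕ} (hR' : R' ≤ R) {A' : Matrix (Fin I) (Fin R') 𝕜} {B' : Matrix (Fin J) (Fin R') 𝕜}
    {C' : Matrix (Fin K) (Fin R') 𝕜} (hT' : IsPD T A' B' C') :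
    ∃ e : Fin R' ≃ Fin R, ∀ j, ∃ t : 𝕜, t ≠ 0 ∧ C'.col j = t • C.col (e j) := by
  classical
  have hspan : Submodule.span 𝕜 (Set.range C.col) = ⊤ := by
    refine Submodule.eq_top_of_finrank_eq ?_
    rw [← rank_eq_finrank_span_cols, hCK, Module.finrank_fin_fun]
  obtain ⟨e, he⟩ := permutation_lemma (F := 𝕜) C.col C'.col (fun r => (hT.1 r).2.2)
    (fun r => (hT'.1 r).2.2) hspan (by simpa using hR') (by
      intro φ hφ
      set f : Fin K → 𝕜 := fun k => φ (Pi.single k 1) with hf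
      simp only [dual_apply_col, ← hf, Module.finrank_fin_fun, Fintype.card_fin] at hφ ⊢
      have h1 : (A * diagonal (f ᵥ* C) * Bᵀ).rank ≤ #{j | (f ᵥ* C') j ≠ 0} := by
        rw [hT.contract_eq f, ← hT'.contract_eq f]
        convert rank_mul_diagonal_mul_transpose_le A' B' (f ᵥ* C')
      have h2 : #{r | (f ᵥ* C) r ≠ 0} < m := by
        convert card_support_lt_of_rank_lt (by omega) A B C U hU hPhi f ?_
        refine lt_of_le_of_lt h1 ?_
        -- The threshold of the permutation lemma is `R - K + 1`, exactly one below `m`.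
        have : #{j | (f ᵥ* C') j ≠ 0} + K ≤ R + 1 := by convert hφ
        omega
      have h3 := rank_mul_diagonal_mul_transpose A B (f ᵥ* C)
        (le_trans (by convert Nat.le_sub_one_of_lt h2) (hkAB.trans (min_le_left _ _)))
        (le_trans (by convert Nat.le_sub_one_of_lt h2) (hkAB.trans (min_le_right _ _)))
      rw [h3] at h1
      convert h1)
  exact ⟨e, fun j => exists_smul_of_span_singleton_eq (hT'.1 j).2.2 (he j)⟩

end Main

end CPD

theorem mainTheorem4 {𝕜 : Type*} [RCLike 𝕜] {I J K R : ℕ}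
    (T : CPD.Tensor 𝕜 I J K)
    (A : Matrix (Fin I) (Fin R) 𝕜) (B : Matrix (Fin J) (Fin R) 𝕜) (C : Matrix (Fin K) (Fin R) 𝕜)
    (hT : CPD.IsPD T A B C)
    (hCK : C.rank = K) (hKR : K ≤ R)
    (m l : ℕ) (hm : m = R - K + 2)
    {u : ℕ} (U : Matrix (CPD.Tuples m l R) (Fin u) 𝕜)
    (hU : CPD.ColumnsFormBasisOfRange U (CPD.S m l C).transpose)
    (hkC : 1 ≤ CPD.kRank C)
    (hAB : CPD.FullColumnRank (CPD.khatriRao A B))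
    (hkAB : m - 1 ≤ min (CPD.kRank A) (CPD.kRank B))
    (hPhi : CPD.FullColumnRank (CPD.Phi m l A B * U)) :
    CPD.tensorRank T = R ∧ CPD.ThirdFactorUnique T := by
  have hrank : CPD.tensorRank T = R := by
    have hle : CPD.tensorRank T ≤ R := Nat.sInf_le ⟨A, B, C, hT⟩
    obtain ⟨A', B', C', hT'⟩ := Nat.sInf_mem (s := {n : ℕ | ∃ (A : Matrix (Fin I) (Fin n) 𝕜)
      (B : Matrix (Fin J) (Fin n) 𝕜) (C : Matrix (Fin K) (Fin n) 𝕜), CPD.IsPD T A B C})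
      ⟨R, A, B, C, hT⟩
    obtain ⟨e, -⟩ := CPD.exists_equiv_of_isPD hT hCK hKR hm U hU hkAB hPhi hle hT'
    simpa using Fintype.card_congr e
  refine ⟨hrank, ?_⟩
  intro R' A₁ A₂ B₁ B₂ C₁ C₂ h₁ h₂
  obtain rfl : R' = R := h₁.2.trans hrank
  obtain ⟨e₁, he₁⟩ := CPD.exists_equiv_of_isPD hT hCK hKR hm U hU hkAB hPhi le_rfl h₁.1
  obtain ⟨e₂, he₂⟩ := CPD.exists_equiv_of_isPD hT hCK hKR hm U hU hkAB hPhi le_rfl h₂.1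
  choose t₁ ht₁ hC₁ using he₁
  choose t₂ ht₂ hC₂ using he₂
  -- Both third factors are compared with `C`; the matchings and scalings are then composed through
  -- it.
  refine ⟨e₂.trans e₁.symm, fun r => t₂ r * (t₁ (e₁.symm (e₂ r)))⁻¹,
    fun r => mul_ne_zero (ht₂ r) (inv_ne_zero (ht₁ _)), fun r => ?_⟩
  rw [hC₂, Equiv.trans_apply, hC₁, Equiv.apply_symm_apply, smul_smul, mul_assoc,
    inv_mul_cancel₀ (ht₁ _), mul_one]
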